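/- Let $U\subset\mathbb{R}^2=\mathbb{C}$ be a bounded simply connected domain and let $\varphi:U\to\mathbb{D}$ be a conformal bijection onto the unit disc. The zero-boundary Gaussian free field (GFF) on $U$ is the centred Gaussian random distribution $X$ on $\mathbb{R}^2$ whose covariance kernel is the Dirichlet Green's function of $U$, extended by zero outside $U\times U$; that is, for all test functions $f,g\in C_c^\infty(\mathbb{R}^2)$, $$\mathbb{E}\,X(f)X(g)=\int_{U\times U} f(x)g(y)\,G_U(x,y)\,dx\,dy,\qquad G_U(x,y)=\log\left|\frac{1-\varphi(x)\overline{\varphi(y)}}{\varphi(x)-\varphi(y)}\right|$$ (the integral converging absolutely; $G_U$ does not depend on the choice of $\varphi$). For $x\neq y$ in $U$, write $\mathbb{E}X(x)X(y)$ for the value at $(x,y)$ of the covariance kernel of $X$ on $U\times U$ that is continuous off the diagonal; such a kernel exists and its values off the diagonal are determined by $X$. Then there is a constant $C>0$ depending only on $U$ such that for every zero-boundary GFF $X$ on $U$, all $N\ge 1$, all $q_1,\dots,q_N\in\{-1,1\}$ and all pairwise distinct points $x_1,\dots,x_N\in U$, $$-\sum_{1\le j<k\le N} q_jq_k\,\mathbb{E}X(x_j)X(x_k)\;\le\;\frac12\sum_{j=1}^N\log\left(\frac{1}{\frac12\min_{k\ne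 j}|x_j-x_k|}\right)+CN .$$ (For $N=1$, where the minimum is over the empty set, the logarithmic term on the right is read as $0$.) -/

import Mathlib

open MeasureTheory ProbabilityTheory TopologicalSpace
open scoped Distributions

noncomputable section

namespace ZeroBoundaryGFF

/-- `φ` is a conformal bijection from `U` onto the unit disc. -/
structure IsConformalToDisc (U : Set ℂ) (φ : ℂ → ℂ) : Prop where
  differentiableOn : DifferentiableOn ℂ φ U
  bijOn : Set.BijOn φ U (Metric.ball (0 : ℂ) 1)

/-- The Dirichlet Green's function of `U`, written through a conformal bijection `φ` of `U` onto
the unit disc: `G_U (x, y) = log |(1 - φ x * conj (φ y)) / (φ x - φ y)|` for `x, y ∈ U`.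
(By conformal invariance the values do not depend on the choice of `φ`.) -/
def greenKernel (φ : ℂ → ℂ) (x y : ℂ) : ℝ :=
  Real.log ‖(1 - φ x * (starRingEnd ℂ) (φ y)) / (φ x - φ y)‖

/-- The random distribution `X` on the plane has covariance kernel `K` on `U × U`, and `0` outside
of `U × U`: for all test functions `f, g` on the plane,
`E[X(f) X(g)] = ∫∫_{U × U} f(x) g(y) K(x, y) dx dy`, the integral being absolutely convergent. -/
structure HasCovarianceKernel {Ω : Type*} [MeasurableSpace Ω] (P : Measure Ω)
    (X : Ω → 𝓓'((⊤ : Opens ℂ), ℝ)) (U : Set ℂ) (K : ℂ → ℂ → ℝ) : Prop where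
  integrableOn : ∀ f g : 𝓓((⊤ : Opens ℂ), ℝ),
    IntegrableOn (fun p : ℂ × ℂ => f p.1 * g p.2 * K p.1 p.2) (U ×ˢ U)
  integral_mul : ∀ f g : 𝓓((⊤ : Opens ℂ), ℝ),
    ∫ ω, X ω f * X ω g ∂P = ∫ p in U ×ˢ U, f p.1 * g p.2 * K p.1 p.2

/-- `X` is a Gaussian free field on `U` with zero boundary conditions: a centred Gaussian random
distribution on the plane whose covariance kernel is the Green's function of `U` (extended by zero
outside of `U × U`). -/
structure IsZeroBoundaryGFF {Ω : Type*} [MeasurableSpace Ω] (P : Measure Ω)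
    (X : Ω → 𝓓'((⊤ : Opens ℂ), ℝ)) (U : Set ℂ) : Prop where
  isGaussianProcess : IsGaussianProcess (fun (f : 𝓓((⊤ : Opens ℂ), ℝ)) (ω : Ω) => X ω f) P
  centered : ∀ f : 𝓓((⊤ : Opens ℂ), ℝ), ∫ ω, X ω f ∂P = 0
  covariance : ∃ φ : ℂ → ℂ, IsConformalToDisc U φ ∧ HasCovarianceKernel P X U (greenKernel φ)

/-- `K` is the pointwise covariance `K(x, y) = E[X(x) X(y)]`, for `x ≠ y` in `U`: the version of the
covariance kernel of `X` on `U × U` that is continuous off the diagonal. As `K` represents the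
covariance of `X` and is continuous there, it is determined by `X` at all `x ≠ y` in `U`. -/
structure IsPointwiseCovariance {Ω : Type*} [MeasurableSpace Ω] (P : Measure Ω)
    (X : Ω → 𝓓'((⊤ : Opens ℂ), ℝ)) (U : Set ℂ) (K : ℂ → ℂ → ℝ) : Prop where
  hasCovarianceKernel : HasCovarianceKernel P X U K
  continuousOn : ContinuousOn (fun p : ℂ × ℂ => K p.1 p.2) {p | p.1 ∈ U ∧ p.2 ∈ U ∧ p.1 ≠ p.2}

/-- `min_{k ≠ j} |x_j - x_k|`. For a single point (`N = 1`) the index set is empty and the value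
is `0`, so that `log (1 / (1/2 * minDist x j))` is `0` in that case. -/
def minDist {N : ℕ} (x : Fin N → ℂ) (j : Fin N) : ℝ :=
  ⨅ k : {k : Fin N // k ≠ j}, ‖x j - x k‖

end ZeroBoundaryGFF

end

/-! The proof is Onsager's electrostatic argument. Through `φ` the Green's function of `U` becomes
`-log d` on the disc, with `d` the pseudo-hyperbolic distance. Replace the point charge `q_j` at
`z_j = φ x_j` by the same charge spread over the pseudo-hyperbolic circle of radius `ρ_j` around
`z_j`. By the mean value property this changes no mutual energy as long as `ρ_j + ρ_k ≤ d(z_j,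
z_k)`, and each smeared charge has the finite self-energy `-log ρ_j`. The total energy `∑ -log ρ_j +
2 ∑_{j<k} q_j q_k G(z_j, z_k)` is nonnegative because the Green's function is positive semidefinite;
this is `neg_sum_discGreen_le`.

Positivity comes from `1 - d² = S` (`one_sub_pseudoDist_sq`), where `S` is the squared modulus of
the normalised Szegő kernel: `-log d = ∑ S^n / (2n)`, and every power of `S` is a positive kernel.
The partial sums are bounded, so the energies are computed for them and passed to the limit by
domination.

The Schwarz lemma for `φ⁻¹` gives `|x - y| ≤ R d(φ x, φ y)` when distances in `U` are at most `R`.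
Hence `ρ_j = min_k |x_j - x_k| / (2R)` is admissible, and `-log ρ_j` is the required logarithm plus
`log R`. Finally, the continuous kernel of `X` must agree with the Green's function off the
diagonal, by testing against bumps. -/

namespace ZeroBoundaryGFF

open Complex Metric Filter Topology ComplexConjugate

/-! ### Pseudo-hyperbolic geometry of the disc -/

/-- The pseudo-hyperbolic distance of the unit disc. -/
noncomputable def pseudoDist (z w : ℂ) : ℝ := ‖(z - w) / (1 - z * conj w)‖

/-- The Möbius transformation of the unit disc that maps `0` to `a`. -/
noncomputable def moebius (a u : ℂ) : ℂ := (u + a) / (1 + conj a * u)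

/-- The squared modulus of the normalised Szegő kernel of the unit disc. -/
noncomputable def szegoSq (z w : ℂ) : ℝ :=
  (1 - ‖z‖ ^ 2) * (1 - ‖w‖ ^ 2) / ‖1 - z * conj w‖ ^ 2

theorem one_sub_mul_conj_ne_zero {z w : ℂ} (hz : ‖z‖ < 1) (hw : ‖w‖ < 1) :
    1 - z * conj w ≠ 0 := by
  intro h
  have h1 : ‖z * conj w‖ = 1 := by rw [← sub_eq_zero.mp h]; simp
  rw [norm_mul, RCLike.norm_conj] at h1
  nlinarith [norm_nonneg z, norm_nonneg w]

theorem one_add_conj_mul_ne_zero {a u : ℂ} (ha : ‖a‖ < 1) (hu : ‖u‖ < 1) :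
    1 + conj a * u ≠ 0 := by
  have := one_sub_mul_conj_ne_zero (z := -u) (w := a) (by simpa using hu) ha
  convert this using 1
  ring

theorem sq_norm_eq_re (z : ℂ) : ((‖z‖ ^ 2 : ℝ) : ℂ) = z * conj z := by
  rw [Complex.mul_conj, Complex.normSq_eq_norm_sq]

theorem pseudoDist_comm (z w : ℂ) : pseudoDist z w = pseudoDist w z := by
  unfold pseudoDist
  rw [norm_div, norm_div, norm_sub_rev, ← RCLike.norm_conj (1 - z * conj w)]
  congr 2
  simp [mul_comm]

theorem pseudoDist_nonneg (z w : ℂ) : 0 ≤ pseudoDist z w := norm_nonneg _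

/-- This is `|1 - z w̄|² - |z - w|² = (1 - |z|²)(1 - |w|²)`. It links the geometry of the disc to
the positivity of its Green's function. -/
theorem one_sub_pseudoDist_sq {z w : ℂ} (hz : ‖z‖ < 1) (hw : ‖w‖ < 1) :
    1 - pseudoDist z w ^ 2 = szegoSq z w := by
  have h := one_sub_mul_conj_ne_zero hz hw
  have h' : ‖1 - z * conj w‖ ^ 2 ≠ 0 := pow_ne_zero 2 (norm_ne_zero_iff.mpr h)
  unfold pseudoDist szegoSq
  rw [norm_div, div_pow, eq_div_iff h', sub_mul, div_mul_cancel₀ _ h', one_mul]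
  apply Complex.ofReal_injective
  push_cast
  have e (z : ℂ) : ((‖z‖ : ℂ)) ^ 2 = z * conj z := by rw [← sq_norm_eq_re]; push_cast; rfl
  simp only [e, map_sub, map_mul, map_one, Complex.conj_conj]
  ring

theorem szegoSq_nonneg {z w : ℂ} (hz : ‖z‖ < 1) (hw : ‖w‖ < 1) : 0 ≤ szegoSq z w := by
  unfold szegoSq
  have h1 : 0 ≤ 1 - ‖z‖ ^ 2 := by nlinarith [norm_nonneg z]
  have h2 : 0 ≤ 1 - ‖w‖ ^ 2 := by nlinarith [norm_nonneg w]
  positivity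

theorem szegoSq_le_one {z w : ℂ} (hz : ‖z‖ < 1) (hw : ‖w‖ < 1) : szegoSq z w ≤ 1 := by
  rw [← one_sub_pseudoDist_sq hz hw]
  nlinarith [sq_nonneg (pseudoDist z w)]

theorem pseudoDist_pos {z w : ℂ} (hz : ‖z‖ < 1) (hw : ‖w‖ < 1) (h : z ≠ w) :
    0 < pseudoDist z w :=
  norm_pos_iff.mpr (div_ne_zero (sub_ne_zero.mpr h) (one_sub_mul_conj_ne_zero hz hw))

theorem pseudoDist_lt_one {z w : ℂ} (hz : ‖z‖ < 1) (hw : ‖w‖ < 1) : pseudoDist z w < 1 := by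
  have h1 : 0 < 1 - ‖z‖ ^ 2 := by nlinarith [norm_nonneg z]
  have h2 : 0 < 1 - ‖w‖ ^ 2 := by nlinarith [norm_nonneg w]
  have h3 : 0 < szegoSq z w := by
    have := norm_pos_iff.mpr (one_sub_mul_conj_ne_zero hz hw)
    unfold szegoSq
    positivity
  rw [← one_sub_pseudoDist_sq hz hw] at h3
  nlinarith [pseudoDist_nonneg z w]

/-- For fixed moduli the distance is least when both points lie on one ray, where it equals `|‖z‖ -
‖w‖| / (1 - ‖z‖‖w‖)`; the denominator is at most `1`. -/
theorem norm_sub_norm_le_pseudoDist {z w : ℂ} (hz : ‖z‖ < 1) (hw : ‖w‖ < 1) :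
    ‖z‖ - ‖w‖ ≤ pseudoDist z w := by
  have h := one_sub_pseudoDist_sq hz hw
  have ha := norm_nonneg z
  have hb := norm_nonneg w
  have hab : ‖z‖ * ‖w‖ < 1 := by nlinarith
  have h1 : 1 - ‖z‖ * ‖w‖ ≤ ‖1 - z * conj w‖ := by
    have := norm_sub_norm_le (1 : ℂ) (z * conj w)
    simpa using this
  have h2 : szegoSq z w ≤ (1 - ‖z‖ ^ 2) * (1 - ‖w‖ ^ 2) / (1 - ‖z‖ * ‖w‖) ^ 2 := by
    unfold szegoSq
    have h3 : 0 ≤ 1 - ‖z‖ ^ 2 := by nlinarith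
    have h4 : 0 ≤ 1 - ‖w‖ ^ 2 := by nlinarith
    have h5 : 0 < 1 - ‖z‖ * ‖w‖ := by linarith
    gcongr
  have h3 : (1 - ‖z‖ ^ 2) * (1 - ‖w‖ ^ 2) / (1 - ‖z‖ * ‖w‖) ^ 2 ≤ 1 - (‖z‖ - ‖w‖) ^ 2 := by
    rw [div_le_iff₀ (by nlinarith)]
    nlinarith [mul_nonneg (sq_nonneg (‖z‖ - ‖w‖)) (mul_nonneg (mul_nonneg ha hb)
      (by linarith : (0 : ℝ) ≤ 2 - ‖z‖ * ‖w‖))]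
  apply le_of_sq_le_sq _ (pseudoDist_nonneg z w)
  linarith

theorem norm_moebius_eq {a u : ℂ} : ‖moebius a u‖ = pseudoDist (-a) u := by
  unfold moebius
  rw [pseudoDist_comm, pseudoDist]
  congr 2
  · ring
  · simp [mul_comm]

theorem norm_moebius_lt_one {a u : ℂ} (ha : ‖a‖ < 1) (hu : ‖u‖ < 1) : ‖moebius a u‖ < 1 := by
  rw [norm_moebius_eq]
  exact pseudoDist_lt_one (by simpa using ha) hu

theorem pseudoDist_moebius {a u v : ℂ} (ha : ‖a‖ < 1) (hu : ‖u‖ < 1) (hv : ‖v‖ < 1) :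
    pseudoDist (moebius a u) (moebius a v) = pseudoDist u v := by
  have h1 := one_add_conj_mul_ne_zero ha hu
  have h2 := one_add_conj_mul_ne_zero ha hv
  have h3 : 1 + a * conj v ≠ 0 := by
    have := (map_ne_zero (starRingEnd ℂ)).mpr h2
    simpa using this
  have h4 : 1 - a * conj a ≠ 0 := one_sub_mul_conj_ne_zero ha ha
  have e1 : moebius a u - moebius a v
      = (1 - a * conj a) * (u - v) / ((1 + conj a * u) * (1 + conj a * v)) := by
    unfold moebius
    rw [div_sub_div _ _ h1 h2]
    congr 1
    ring
  have e2 : 1 - moebius a u * conj (moebius a v)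
      = (1 - a * conj a) * (1 - u * conj v) / ((1 + conj a * u) * (1 + a * conj v)) := by
    unfold moebius
    simp only [map_div₀, map_add, map_mul, map_one, Complex.conj_conj]
    rw [div_mul_div_comm, eq_div_iff (mul_ne_zero h1 h3), sub_mul,
      div_mul_cancel₀ _ (mul_ne_zero h1 h3)]
    ring
  have h5 : ‖1 + a * conj v‖ = ‖1 + conj a * v‖ := by
    rw [← RCLike.norm_conj]; simp
  unfold pseudoDist
  rw [e1, e2]
  simp only [norm_div, norm_mul, h5]
  have n1 := norm_ne_zero_iff.mpr h1
  have n2 := norm_ne_zero_iff.mpr h2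
  have n4 := norm_ne_zero_iff.mpr h4
  field_simp

theorem moebius_moebius_neg {a w : ℂ} (ha : ‖a‖ < 1) (hw : ‖w‖ < 1) :
    moebius a (moebius (-a) w) = w := by
  have h1 : 1 - conj a * w ≠ 0 := by
    have := one_add_conj_mul_ne_zero (a := -a) (by simpa using ha) hw
    simpa [sub_eq_add_neg] using this
  have h4 : 1 - a * conj a ≠ 0 := one_sub_mul_conj_ne_zero ha ha
  unfold moebius
  simp only [map_neg, neg_mul, ← sub_eq_add_neg]
  have e1 : (w - a) / (1 - conj a * w) + a = (1 - a * conj a) * w / (1 - conj a * w) := by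
    rw [eq_div_iff h1, add_mul, div_mul_cancel₀ _ h1]; ring
  have e2 : 1 + conj a * ((w - a) / (1 - conj a * w)) = (1 - a * conj a) / (1 - conj a * w) := by
    rw [eq_div_iff h1, add_mul, mul_assoc, div_mul_cancel₀ _ h1]; ring
  rw [e1, e2]
  field_simp

theorem pseudoDist_moebius_left {a u w : ℂ} (ha : ‖a‖ < 1) (hu : ‖u‖ < 1) (hw : ‖w‖ < 1) :
    pseudoDist (moebius a u) w = pseudoDist u (moebius (-a) w) := by
  have h := norm_moebius_lt_one (a := -a) (by simpa using ha) hw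
  conv_lhs => rw [← moebius_moebius_neg ha hw]
  exact pseudoDist_moebius ha hu h

theorem norm_moebius_neg (a w : ℂ) : ‖moebius (-a) w‖ = pseudoDist a w := by
  rw [norm_moebius_eq, neg_neg]

theorem pseudoDist_self_moebius {a u : ℂ} (ha : ‖a‖ < 1) (hu : ‖u‖ < 1) :
    pseudoDist a (moebius a u) = ‖u‖ := by
  have : moebius a 0 = a := by simp [moebius]
  have h := pseudoDist_moebius ha (by simp : ‖(0 : ℂ)‖ < 1) hu
  rw [this] at h
  rw [h]
  simp [pseudoDist]

/-- A triangle inequality, reduced to the previous bound on moduli by the Möbius map that moves `a`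
to `0`. -/
theorem pseudoDist_sub_le {a b u : ℂ} (ha : ‖a‖ < 1) (hb : ‖b‖ < 1) (hu : ‖u‖ < 1) :
    pseudoDist a b - ‖u‖ ≤ pseudoDist b (moebius a u) := by
  rw [pseudoDist_comm b, pseudoDist_moebius_left ha hu hb, pseudoDist_comm u, ← norm_moebius_neg]
  exact norm_sub_norm_le_pseudoDist (norm_moebius_lt_one (by simpa using ha) hb) hu

/-! ### Green's function of the disc and its expansion in Szegő kernels -/

/-- The Green's function of the unit disc. -/
noncomputable def discGreen (z w : ℂ) : ℝ := -Real.log (pseudoDist z w)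

theorem greenKernel_eq_discGreen (φ : ℂ → ℂ) (x y : ℂ) :
    greenKernel φ x y = discGreen (φ x) (φ y) := by
  unfold greenKernel discGreen pseudoDist
  rw [← Real.log_inv, ← norm_inv, inv_div]

theorem discGreen_comm (z w : ℂ) : discGreen z w = discGreen w z := by
  rw [discGreen, pseudoDist_comm, discGreen]

theorem hasSum_szegoSq_pow {z w : ℂ} (hz : ‖z‖ < 1) (hw : ‖w‖ < 1) (h : z ≠ w) :
    HasSum (fun n : ℕ => szegoSq z w ^ (n + 1) / (2 * (n + 1))) (discGreen z w) := by
  have hp := pseudoDist_pos hz hw h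
  have hk := one_sub_pseudoDist_sq hz hw
  have h0 := szegoSq_nonneg hz hw
  have := Real.hasSum_pow_div_log_of_abs_lt_one (x := szegoSq z w)
    (by rw [abs_of_nonneg h0, ← hk]; nlinarith)
  rw [show 1 - szegoSq z w = pseudoDist z w ^ 2 by linarith, Real.log_pow] at this
  have h2 := this.div_const 2
  rw [show -(((2 : ℕ) : ℝ) * Real.log (pseudoDist z w)) / 2 = discGreen z w by
    unfold discGreen; push_cast; ring] at h2
  refine h2.congr_fun ?_
  intro n
  field_simp

/-- The partial sums of the expansion of `discGreen` in powers of `szegoSq`. -/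
noncomputable def discGreenPartial (m : ℕ) (z w : ℂ) : ℝ :=
  ∑ n ∈ Finset.range m, szegoSq z w ^ (n + 1) / (2 * (n + 1))

theorem discGreenPartial_nonneg (m : ℕ) {z w : ℂ} (hz : ‖z‖ < 1) (hw : ‖w‖ < 1) :
    0 ≤ discGreenPartial m z w := by
  have := szegoSq_nonneg hz hw
  exact Finset.sum_nonneg fun n _ => by positivity

theorem discGreenPartial_le (m : ℕ) {z w : ℂ} (hz : ‖z‖ < 1) (hw : ‖w‖ < 1) (h : z ≠ w) :
    discGreenPartial m z w ≤ discGreen z w := by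
  have := szegoSq_nonneg hz hw
  exact sum_le_hasSum _ (fun n _ => by positivity) (hasSum_szegoSq_pow hz hw h)

theorem tendsto_discGreenPartial {z w : ℂ} (hz : ‖z‖ < 1) (hw : ‖w‖ < 1) (h : z ≠ w) :
    Tendsto (fun m => discGreenPartial m z w) atTop (𝓝 (discGreen z w)) :=
  (hasSum_szegoSq_pow hz hw h).tendsto_sum_nat

@[fun_prop]
theorem measurable_szegoSq : Measurable fun p : ℂ × ℂ => szegoSq p.1 p.2 := by
  unfold szegoSq
  fun_prop

@[fun_prop]
theorem measurable_discGreenPartial (m : ℕ) :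
    Measurable fun p : ℂ × ℂ => discGreenPartial m p.1 p.2 := by
  unfold discGreenPartial
  have := measurable_szegoSq
  fun_prop

theorem _root_.Measurable.discGreenPartial {T : Type*} [MeasurableSpace T] {f g : T → ℂ}
    (hf : Measurable f) (hg : Measurable g) (m : ℕ) :
    Measurable fun t => discGreenPartial m (f t) (g t) := by
  have h := (measurable_discGreenPartial m).comp (hf.prodMk hg)
  exact h

/-! ### Potentials and energies of charges spread over circles -/

/-- The uniform probability measure on the angles `(0, 2π]`. -/
noncomputable def angleMeasure : Measure ℝ :=
  ENNReal.ofReal (2 * Real.pi)⁻¹ • volume.restrict (Set.Ioc 0 (2 * Real.pi))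

instance : IsProbabilityMeasure angleMeasure := by
  constructor
  have := Real.two_pi_pos
  rw [angleMeasure, Measure.smul_apply, Measure.restrict_apply_univ, Real.volume_Ioc, smul_eq_mul,
    ← ENNReal.ofReal_mul (by positivity), sub_zero, inv_mul_cancel₀ this.ne', ENNReal.ofReal_one]

theorem integral_angleMeasure (f : ℂ → ℝ) (c : ℂ) (R : ℝ) :
    ∫ θ, f (circleMap c R θ) ∂angleMeasure = Real.circleAverage f c R := by
  have := Real.two_pi_pos
  rw [angleMeasure, integral_smul_measure, Real.circleAverage,
    intervalIntegral.integral_of_le this.le, ENNReal.toReal_ofReal (by positivity)]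

theorem integrable_angleMeasure {f : ℂ → ℝ} {c : ℂ} {R : ℝ} (h : CircleIntegrable f c R) :
    Integrable (fun θ => f (circleMap c R θ)) angleMeasure := by
  have := Real.two_pi_pos
  refine Integrable.smul_measure ?_ ENNReal.ofReal_ne_top
  exact (intervalIntegrable_iff_integrableOn_Ioc_of_le this.le).mp h

theorem ae_circleMap_ne {R : ℝ} (hR : R ≠ 0) (w : ℂ) :
    ∀ᵐ θ ∂angleMeasure, circleMap 0 R θ ≠ w := by
  have h : angleMeasure ≪ volume :=
    (Measure.smul_absolutelyContinuous).trans Measure.restrict_le_self.absolutelyContinuous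
  exact h.ae_le (measure_eq_zero_iff_ae_notMem.mp
    (((Set.countable_singleton w).preimage_circleMap 0 hR).measure_zero volume))

theorem norm_circleMap_zero_of_nonneg {ρ : ℝ} (hρ : 0 ≤ ρ) (θ : ℝ) : ‖circleMap 0 ρ θ‖ = ρ := by
  rw [norm_circleMap_zero, abs_of_nonneg hρ]

theorem harmonicOnNhd_log_norm_one_sub_mul {ρ : ℝ} (hρ : 0 < ρ) (hρ1 : ρ < 1) {w : ℂ}
    (hw : ‖w‖ < 1) :
    InnerProductSpace.HarmonicOnNhd (fun u => Real.log ‖1 - u * conj w‖) (closedBall 0 |ρ|) := by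
  intro x hx
  have hx' : ‖x‖ < 1 := by
    rw [mem_closedBall, dist_zero_right, abs_of_pos hρ] at hx
    linarith
  exact AnalyticAt.harmonicAt_log_norm (by fun_prop) (one_sub_mul_conj_ne_zero hx' hw)

theorem circleIntegrable_log_norm_one_sub_mul (ρ : ℝ) (w : ℂ) :
    CircleIntegrable (fun u => Real.log ‖1 - u * conj w‖) 0 ρ :=
  MeromorphicOn.circleIntegrable_log_norm (f := fun u => 1 - u * conj w) (fun z _ => by fun_prop)

theorem discGreen_circleMap_ae_eq {ρ : ℝ} (hρ : 0 < ρ) (hρ1 : ρ < 1) {w : ℂ} (hw : ‖w‖ < 1) :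
    (fun θ => discGreen (circleMap 0 ρ θ) w) =ᵐ[angleMeasure] fun θ =>
      Real.log ‖1 - circleMap 0 ρ θ * conj w‖ - Real.log ‖circleMap 0 ρ θ - w‖ := by
  filter_upwards [ae_circleMap_ne hρ.ne' w] with θ hθ
  have h1 : ‖circleMap 0 ρ θ‖ < 1 := by rwa [norm_circleMap_zero_of_nonneg hρ.le]
  rw [discGreen, pseudoDist, norm_div, Real.log_div
    (norm_ne_zero_iff.mpr (sub_ne_zero.mpr hθ))
    (norm_ne_zero_iff.mpr (one_sub_mul_conj_ne_zero h1 hw))]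
  ring

theorem integrable_discGreen_circleMap {ρ : ℝ} (hρ : 0 < ρ) (hρ1 : ρ < 1) {w : ℂ}
    (hw : ‖w‖ < 1) : Integrable (fun θ => discGreen (circleMap 0 ρ θ) w) angleMeasure := by
  rw [integrable_congr (discGreen_circleMap_ae_eq hρ hρ1 hw)]
  exact (integrable_angleMeasure (circleIntegrable_log_norm_one_sub_mul ρ w)).sub
    (integrable_angleMeasure (circleIntegrable_log_norm_sub_const (c := 0) (a := w) ρ))

/-- The term `log |1 - u w̄|` is harmonic in the disc and averages to its value `0` at the centre.
Jensen's formula gives `log ρ + log⁺ (|w| / ρ) = log (max ρ |w|)` for the other term. -/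
theorem integral_discGreen_circleMap {ρ : ℝ} (hρ : 0 < ρ) (hρ1 : ρ < 1) {w : ℂ}
    (hw : ‖w‖ < 1) :
    ∫ θ, discGreen (circleMap 0 ρ θ) w ∂angleMeasure = -Real.log (max ρ ‖w‖) := by
  rw [integral_congr_ae (discGreen_circleMap_ae_eq hρ hρ1 hw),
    integral_sub (integrable_angleMeasure (circleIntegrable_log_norm_one_sub_mul ρ w))
    (integrable_angleMeasure (circleIntegrable_log_norm_sub_const (c := 0) (a := w) ρ)),
    integral_angleMeasure (fun u => Real.log ‖1 - u * conj w‖),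
    integral_angleMeasure (fun u => Real.log ‖u - w‖),
    (harmonicOnNhd_log_norm_one_sub_mul hρ hρ1 hw).circleAverage_eq,
    circleAverage_log_norm_sub_const_eq_log_radius_add_posLog hρ.ne']
  simp only [zero_mul, sub_zero, norm_one, Real.log_one, zero_sub, norm_neg, neg_inj]
  rcases le_total ‖w‖ ρ with h | h
  · rw [max_eq_left h, add_eq_left, Real.posLog_eq_zero_iff, abs_of_nonneg (by positivity)]
    exact inv_mul_le_one_of_le₀ h hρ.le
  · have hw0 : 0 < ‖w‖ := hρ.trans_le h
    rw [max_eq_right h, Real.posLog_eq_log, Real.log_mul (by positivity) hw0.ne', Real.log_inv]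
    · ring
    · rw [abs_of_nonneg (by positivity), ← div_eq_inv_mul, le_div_iff₀ hρ]
      linarith

/-- The pseudo-hyperbolic circle with centre `a` and radius `ρ`. -/
noncomputable def hypCircle (a : ℂ) (ρ θ : ℝ) : ℂ := moebius a (circleMap 0 ρ θ)

theorem norm_hypCircle_lt_one {a : ℂ} (ha : ‖a‖ < 1) {ρ : ℝ} (hρ : 0 < ρ) (hρ1 : ρ < 1) (θ : ℝ) :
    ‖hypCircle a ρ θ‖ < 1 :=
  norm_moebius_lt_one ha (by rwa [norm_circleMap_zero_of_nonneg hρ.le])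

@[fun_prop]
theorem measurable_hypCircle (a : ℂ) (ρ : ℝ) : Measurable (hypCircle a ρ) := by
  unfold hypCircle moebius
  have : Measurable (circleMap 0 ρ) := (continuous_circleMap 0 ρ).measurable
  fun_prop

theorem discGreen_hypCircle {a w : ℂ} (ha : ‖a‖ < 1) (hw : ‖w‖ < 1) {ρ : ℝ} (hρ : 0 < ρ)
    (hρ1 : ρ < 1) (θ : ℝ) :
    discGreen w (hypCircle a ρ θ) = discGreen (circleMap 0 ρ θ) (moebius (-a) w) := by
  rw [discGreen_comm, discGreen, hypCircle, pseudoDist_moebius_left ha _ hw, discGreen]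
  rwa [norm_circleMap_zero_of_nonneg hρ.le]

theorem integrable_discGreen_hypCircle {a w : ℂ} (ha : ‖a‖ < 1) (hw : ‖w‖ < 1) {ρ : ℝ}
    (hρ : 0 < ρ) (hρ1 : ρ < 1) :
    Integrable (fun θ => discGreen w (hypCircle a ρ θ)) angleMeasure := by
  simp_rw [discGreen_hypCircle ha hw hρ hρ1]
  exact integrable_discGreen_circleMap hρ hρ1 (norm_moebius_lt_one (by simpa using ha) hw)

/-- Newton's theorem, by Möbius invariance: the smeared charge has the potential of a point charge
outside its circle and a constant potential inside. -/
theorem integral_discGreen_hypCircle {a w : ℂ} (ha : ‖a‖ < 1) (hw : ‖w‖ < 1) {ρ : ℝ}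
    (hρ : 0 < ρ) (hρ1 : ρ < 1) :
    ∫ θ, discGreen w (hypCircle a ρ θ) ∂angleMeasure = -Real.log (max ρ (pseudoDist a w)) := by
  simp_rw [discGreen_hypCircle ha hw hρ hρ1]
  rw [integral_discGreen_circleMap hρ hρ1 (norm_moebius_lt_one (by simpa using ha) hw),
    norm_moebius_neg]

theorem ae_ne_hypCircle {a w : ℂ} (ha : ‖a‖ < 1) (hw : ‖w‖ < 1) {ρ : ℝ}
    (hρ : 0 < ρ) (hρ1 : ρ < 1) : ∀ᵐ θ ∂angleMeasure, w ≠ hypCircle a ρ θ := by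
  filter_upwards [ae_circleMap_ne hρ.ne' (moebius (-a) w)] with θ hθ h
  apply hθ
  have hc : ‖circleMap 0 ρ θ‖ < 1 := by rwa [norm_circleMap_zero_of_nonneg hρ.le]
  have h1 := pseudoDist_moebius_left ha hc hw
  have h2 : pseudoDist (moebius a (circleMap 0 ρ θ)) w = 0 := by
    rw [h, hypCircle]
    simp [pseudoDist]
  by_contra h3
  have := pseudoDist_pos hc (norm_moebius_lt_one (a := -a) (by simpa using ha) hw) h3
  linarith

theorem tendsto_integral_discGreenPartial {a w : ℂ} (ha : ‖a‖ < 1) (hw : ‖w‖ < 1) {ρ : ℝ}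
    (hρ : 0 < ρ) (hρ1 : ρ < 1) :
    Tendsto (fun m => ∫ θ, discGreenPartial m w (hypCircle a ρ θ) ∂angleMeasure) atTop
      (𝓝 (-Real.log (max ρ (pseudoDist a w)))) := by
  rw [← integral_discGreen_hypCircle ha hw hρ hρ1]
  refine tendsto_integral_of_dominated_convergence _ (fun m => ?_)
    (integrable_discGreen_hypCircle ha hw hρ hρ1) (fun m => ?_) ?_
  · exact (measurable_const.discGreenPartial (measurable_hypCircle a ρ) m).aestronglyMeasurable
  · filter_upwards [ae_ne_hypCircle ha hw hρ hρ1] with θ hθ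
    have h := norm_hypCircle_lt_one ha hρ hρ1 θ
    rw [Real.norm_of_nonneg (discGreenPartial_nonneg m hw h)]
    exact discGreenPartial_le m hw h hθ
  · filter_upwards [ae_ne_hypCircle ha hw hρ hρ1] with θ hθ
    exact tendsto_discGreenPartial hw (norm_hypCircle_lt_one ha hρ hρ1 θ) hθ

/-- The bound does not depend on `m` or `w`, so it dominates the outer integral in the double limit
below. -/
theorem integral_discGreenPartial_le {a w : ℂ} (ha : ‖a‖ < 1) (hw : ‖w‖ < 1) {ρ : ℝ}
    (hρ : 0 < ρ) (hρ1 : ρ < 1) (m : ℕ) :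
    ∫ θ, discGreenPartial m w (hypCircle a ρ θ) ∂angleMeasure ≤ -Real.log ρ := by
  have h1 : ∫ θ, discGreenPartial m w (hypCircle a ρ θ) ∂angleMeasure
      ≤ ∫ θ, discGreen w (hypCircle a ρ θ) ∂angleMeasure := by
    refine integral_mono_of_nonneg
      (Eventually.of_forall fun θ => discGreenPartial_nonneg m hw
        (norm_hypCircle_lt_one ha hρ hρ1 θ))
      (integrable_discGreen_hypCircle ha hw hρ hρ1) ?_
    filter_upwards [ae_ne_hypCircle ha hw hρ hρ1] with θ hθ
    exact discGreenPartial_le m hw (norm_hypCircle_lt_one ha hρ hρ1 θ) hθ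
  rw [integral_discGreen_hypCircle ha hw hρ hρ1] at h1
  have := Real.log_le_log hρ (le_max_left ρ (pseudoDist a w))
  linarith

theorem tendsto_integral_integral_discGreenPartial {a b : ℂ} (ha : ‖a‖ < 1) (hb : ‖b‖ < 1)
    {ρ σ : ℝ} (hρ : 0 < ρ) (hρ1 : ρ < 1) (hσ : 0 < σ) (hσ1 : σ < 1) :
    Tendsto (fun m => ∫ θ, ∫ ψ, discGreenPartial m (hypCircle b σ θ) (hypCircle a ρ ψ)
        ∂angleMeasure ∂angleMeasure) atTop
      (𝓝 (∫ θ, -Real.log (max ρ (pseudoDist a (hypCircle b σ θ))) ∂angleMeasure)) := by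
  refine tendsto_integral_of_dominated_convergence (fun _ => -Real.log ρ) (fun m => ?_)
    (integrable_const _) (fun m => ?_) ?_
  · have h := (((measurable_hypCircle b σ).comp measurable_fst).discGreenPartial
      ((measurable_hypCircle a ρ).comp measurable_snd) m).stronglyMeasurable.integral_prod_right'
        (ν := angleMeasure) (α := ℝ)
    exact h.aestronglyMeasurable
  · refine Eventually.of_forall fun θ => ?_
    have h := norm_hypCircle_lt_one hb hσ hσ1 θ
    rw [Real.norm_of_nonneg (integral_nonneg fun ψ => discGreenPartial_nonneg m h
        (norm_hypCircle_lt_one ha hρ hρ1 ψ))]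
    exact integral_discGreenPartial_le ha h hρ hρ1 m
  · exact Eventually.of_forall fun θ => tendsto_integral_discGreenPartial ha
      (norm_hypCircle_lt_one hb hσ hσ1 θ) hρ hρ1

theorem integral_log_max_self {a : ℂ} (ha : ‖a‖ < 1) {ρ : ℝ} (hρ : 0 < ρ) (hρ1 : ρ < 1) :
    ∫ θ, -Real.log (max ρ (pseudoDist a (hypCircle a ρ θ))) ∂angleMeasure = -Real.log ρ := by
  have h (θ : ℝ) : pseudoDist a (hypCircle a ρ θ) = ρ := by
    have hc := norm_circleMap_zero_of_nonneg hρ.le θ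
    rw [hypCircle, pseudoDist_self_moebius ha (by rwa [hc]), hc]
  simp [h]

/-- The circle around `b` stays outside the disc of radius `ρ` around `a`, so the maximum is the
distance itself; the mean value property around `b` then finishes. -/
theorem integral_log_max_of_add_le {a b : ℂ} (ha : ‖a‖ < 1) (hb : ‖b‖ < 1) {ρ σ : ℝ}
    (hρ : 0 < ρ) (hσ : 0 < σ) (hσ1 : σ < 1) (h : ρ + σ ≤ pseudoDist a b) :
    ∫ θ, -Real.log (max ρ (pseudoDist a (hypCircle b σ θ))) ∂angleMeasure = discGreen a b := by
  have h1 (θ : ℝ) : max ρ (pseudoDist a (hypCircle b σ θ)) = pseudoDist a (hypCircle b σ θ) := by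
    have hc := norm_circleMap_zero_of_nonneg hσ.le θ
    have := pseudoDist_sub_le (u := circleMap 0 σ θ) hb ha (by rwa [hc])
    rw [hc, pseudoDist_comm] at this
    exact max_eq_right (by unfold hypCircle; linarith)
  have h2 := integral_discGreen_hypCircle hb ha hσ hσ1
  rw [pseudoDist_comm b, max_eq_right (by linarith)] at h2
  simp_rw [h1]
  exact h2

/-! ### Positive semidefinite kernels -/

/-- A bounded measurable kernel that is positive semidefinite when integrated against bounded
measurable functions. -/
structure IsPosKernel {T : Type*} [MeasurableSpace T] (ν : Measure T) (K : T → T → ℂ) : Prop where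
  measurable : Measurable fun p : T × T => K p.1 p.2
  bounded : ∃ C, ∀ s t, ‖K s t‖ ≤ C
  nonneg : ∀ f : T → ℂ, Measurable f → (∃ C, ∀ t, ‖f t‖ ≤ C) →
    0 ≤ (∫ p : T × T, f p.1 * conj (f p.2) * K p.1 p.2 ∂ν.prod ν).re

namespace IsPosKernel

theorem norm_mul_mul_le {T : Type*} {f : T → ℂ} {C D : ℝ} (hf : ∀ t, ‖f t‖ ≤ C) {z : ℂ} (hz : ‖z‖ ≤ D)
    (p : T × T) : ‖f p.1 * conj (f p.2) * z‖ ≤ C * C * D := by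
  have hC : 0 ≤ C := (norm_nonneg _).trans (hf p.1)
  rw [norm_mul, norm_mul, RCLike.norm_conj]
  have := hf p.1
  have := hf p.2
  gcongr

variable {T : Type*} [MeasurableSpace T] {ν : Measure T} {K L : T → T → ℂ}

theorem exists_bound (hK : IsPosKernel ν K) : ∃ C, 0 ≤ C ∧ ∀ s t, ‖K s t‖ ≤ C := by
  obtain ⟨C, hC⟩ := hK.bounded
  exact ⟨|C|, abs_nonneg C, fun s t => (hC s t).trans (le_abs_self C)⟩

theorem zero : IsPosKernel ν fun _ _ => 0 :=
  ⟨measurable_const, ⟨0, by simp⟩, fun f hf hb => by simp⟩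

/-- The factor `A` is absorbed into the test function. -/
theorem conj_mul (hK : IsPosKernel ν K) {A : T → ℂ} (hA : Measurable A)
    (hb : ∃ C, ∀ t, ‖A t‖ ≤ C) : IsPosKernel ν fun s t => A s * conj (A t) * K s t := by
  have hc : Measurable (starRingEnd ℂ) := Complex.continuous_conj.measurable
  have hm := hK.measurable
  obtain ⟨C, hC⟩ := hb
  refine ⟨by fun_prop, ?_, fun f hf hfb => ?_⟩
  · obtain ⟨D, hD⟩ := hK.bounded
    exact ⟨C * C * D, fun s t => norm_mul_mul_le hC (hD s t) (s, t)⟩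
  · obtain ⟨D, hD⟩ := hfb
    have := hK.nonneg (fun t => f t * A t) (hf.mul hA) ⟨D * C, fun t => by
      rw [norm_mul]
      have := hC t
      have := hD t
      have : 0 ≤ D := (norm_nonneg _).trans (hD t)
      gcongr⟩
    convert this using 4 with p
    rw [map_mul]
    ring

variable [IsFiniteMeasure ν]

theorem integrable (hK : IsPosKernel ν K) {f : T → ℂ} (hf : Measurable f)
    (hb : ∃ C, ∀ t, ‖f t‖ ≤ C) :
    Integrable (fun p : T × T => f p.1 * conj (f p.2) * K p.1 p.2) (ν.prod ν) := by
  obtain ⟨C, hC⟩ := hb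
  obtain ⟨D, hD⟩ := hK.bounded
  have := hK.measurable
  refine Integrable.of_bound (C := C * C * D) ?_ (Eventually.of_forall fun p => ?_)
  · exact Measurable.aestronglyMeasurable (by
      have : Measurable (starRingEnd ℂ) := Complex.continuous_conj.measurable
      fun_prop)
  · exact norm_mul_mul_le hC (hD _ _) p

theorem one : IsPosKernel ν fun _ _ => 1 := by
  refine ⟨measurable_const, ⟨1, by simp⟩, fun f hf hb => ?_⟩
  simp only [mul_one]
  rw [integral_prod_mul f (fun t => conj (f t)), integral_conj, Complex.mul_conj,
    Complex.ofReal_re]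
  exact Complex.normSq_nonneg _

theorem add (hK : IsPosKernel ν K) (hL : IsPosKernel ν L) :
    IsPosKernel ν fun s t => K s t + L s t := by
  refine ⟨hK.measurable.add hL.measurable, ?_, fun f hf hb => ?_⟩
  · obtain ⟨C, hC⟩ := hK.bounded
    obtain ⟨D, hD⟩ := hL.bounded
    exact ⟨C + D, fun s t => (norm_add_le _ _).trans (add_le_add (hC s t) (hD s t))⟩
  · simp only [mul_add]
    rw [integral_add (hK.integrable hf hb) (hL.integrable hf hb), Complex.add_re]
    exact add_nonneg (hK.nonneg f hf hb) (hL.nonneg f hf hb)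

theorem sum {ι : Type*} (S : Finset ι) {K : ι → T → T → ℂ}
    (h : ∀ i ∈ S, IsPosKernel ν (K i)) : IsPosKernel ν fun s t => ∑ i ∈ S, K i s t := by
  classical
  induction S using Finset.induction_on with
  | empty => simpa using zero
  | insert i S hi ih =>
    simp only [Finset.sum_insert hi]
    exact (h i (by simp)).add (ih fun j hj => h j (by simp [hj]))

theorem of_tendsto {K : ℕ → T → T → ℂ} {L : T → T → ℂ} (hK : ∀ m, IsPosKernel ν (K m)) {C : ℝ}
    (hC : ∀ m s t, ‖K m s t‖ ≤ C) (h : ∀ s t, Tendsto (fun m => K m s t) atTop (𝓝 (L s t))) :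
    IsPosKernel ν L := by
  refine ⟨measurable_of_tendsto_metrizable (fun m => (hK m).measurable)
    (tendsto_pi_nhds.mpr fun p => h p.1 p.2),
    ⟨C, fun s t => le_of_tendsto (h s t).norm (Eventually.of_forall fun m => hC m s t)⟩,
    fun f hf hb => ?_⟩
  have hlim : Tendsto (fun m => ∫ p : T × T, f p.1 * conj (f p.2) * K m p.1 p.2 ∂ν.prod ν) atTop
      (𝓝 (∫ p : T × T, f p.1 * conj (f p.2) * L p.1 p.2 ∂ν.prod ν)) := by
    obtain ⟨D, hD⟩ := hb
    refine tendsto_integral_of_dominated_convergence (fun _ => D * D * C)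
      (fun m => ((hK m).integrable hf ⟨D, hD⟩).aestronglyMeasurable) (integrable_const _)
      (fun m => Eventually.of_forall fun p => norm_mul_mul_le hD (hC m _ _) p)
      (Eventually.of_forall fun p => (h p.1 p.2).const_mul _)
  exact ge_of_tendsto ((Complex.continuous_re.tendsto _).comp hlim)
    (Eventually.of_forall fun m => (hK m).nonneg f hf hb)

/-- In the geometric series each term multiplies `K` by `A s * conj (A t)` with `A = z ^ n`, which
is covered by `conj_mul`. The uniform bound `r < 1` gives bounded convergence. -/
theorem mul_inv_one_sub (hK : IsPosKernel ν K) {z : T → ℂ} (hz : Measurable z) {r : ℝ}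
    (hr : r < 1) (hzr : ∀ t, ‖z t‖ ≤ r) :
    IsPosKernel ν fun s t => (1 - z s * conj (z t))⁻¹ * K s t := by
  obtain ⟨D, hD0, hD⟩ := hK.exists_bound
  have hx (s t : T) : ‖z s * conj (z t)‖ ≤ |r| := by
    have h1 := hzr s
    have h2 := hzr t
    have h0 := (norm_nonneg _).trans h1
    rw [norm_mul, RCLike.norm_conj, abs_of_nonneg h0]
    nlinarith [norm_nonneg (z s), norm_nonneg (z t)]
  -- Only a point of `T` forces `0 ≤ r`, and hence `|r| < 1`.
  rcases isEmpty_or_nonempty T with hT | ⟨⟨t₀⟩⟩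
  · exact ⟨measurable_of_empty _, ⟨0, fun s => isEmptyElim s⟩, fun f _ _ => by
      simp [Measure.eq_zero_of_isEmpty]⟩
  have hr1 : |r| < 1 := by
    rwa [abs_of_nonneg ((norm_nonneg _).trans (hzr t₀))]
  refine of_tendsto (K := fun m s t => (∑ n ∈ Finset.range m, (z s * conj (z t)) ^ n) * K s t)
    (C := (1 - |r|)⁻¹ * D) (fun m => ?_) (fun m s t => ?_) (fun s t => ?_)
  · simp only [Finset.sum_mul]
    refine sum _ fun n _ => ?_
    simp only [mul_pow, ← map_pow]
    refine hK.conj_mul (hz.pow_const n) ⟨1, fun t => ?_⟩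
    rw [norm_pow]
    exact pow_le_one₀ (norm_nonneg _) ((hzr t).trans hr.le)
  · rw [norm_mul]
    refine mul_le_mul ?_ (hD s t) (norm_nonneg _) (inv_nonneg.mpr (by linarith))
    calc ‖∑ n ∈ Finset.range m, (z s * conj (z t)) ^ n‖
        ≤ ∑ n ∈ Finset.range m, |r| ^ n := norm_sum_le_of_le _ fun n _ => by
          rw [norm_pow]
          exact pow_le_pow_left₀ (norm_nonneg _) (hx s t) n
      _ ≤ (1 - |r|)⁻¹ := sum_le_hasSum _ (fun n _ => by positivity)
          (hasSum_geometric_of_lt_one (abs_nonneg r) hr1)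
  · exact ((hasSum_geometric_of_norm_lt_one ((hx s t).trans_lt hr1)).tendsto_sum_nat).mul_const _

/-- Since `|1 - z w̄|⁻² = (1 - z w̄)⁻¹ (1 - z̄ w)⁻¹`, the geometric series step applies twice, to
`z` and to its conjugate; the weights `1 - |z|²` enter by `conj_mul`. -/
theorem mul_szegoSq (hK : IsPosKernel ν K) {z : T → ℂ} (hz : Measurable z) {r : ℝ}
    (hr : r < 1) (hzr : ∀ t, ‖z t‖ ≤ r) :
    IsPosKernel ν fun s t => (szegoSq (z s) (z t) : ℂ) * K s t := by
  have hc : Measurable (starRingEnd ℂ) := Complex.continuous_conj.measurable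
  have h := ((hK.mul_inv_one_sub hz hr hzr).mul_inv_one_sub (z := fun t => conj (z t))
    (by fun_prop) hr (by simpa using hzr)).conj_mul (A := fun t => ((1 - ‖z t‖ ^ 2 : ℝ) : ℂ))
    (by fun_prop) ⟨1, fun t => by
      have := hzr t
      have := norm_nonneg (z t)
      rw [Complex.norm_real, Real.norm_of_nonneg (by nlinarith)]
      nlinarith⟩
  convert h using 3 with s t
  have e : ((‖1 - z s * conj (z t)‖ : ℂ)) ^ 2
      = (1 - z s * conj (z t)) * (1 - conj (z s) * conj (conj (z t))) := by
    rw [← Complex.ofReal_pow, sq_norm_eq_re]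
    simp
  rw [szegoSq, Complex.ofReal_div, Complex.ofReal_mul, Complex.ofReal_pow, e, Complex.conj_ofReal,
    div_eq_mul_inv, mul_inv]
  ring

theorem szegoSq_pow {z : T → ℂ} (hz : Measurable z) {r : ℝ} (hr : r < 1)
    (hzr : ∀ t, ‖z t‖ ≤ r) (n : ℕ) :
    IsPosKernel ν fun s t => ((szegoSq (z s) (z t) ^ n : ℝ) : ℂ) := by
  induction n with
  | zero => simpa using one
  | succ n ih =>
    have := ih.mul_szegoSq hz hr hzr
    simpa [pow_succ'] using this

theorem discGreenPartial {z : T → ℂ} (hz : Measurable z) {r : ℝ} (hr : r < 1)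
    (hzr : ∀ t, ‖z t‖ ≤ r) (m : ℕ) :
    IsPosKernel ν fun s t => (discGreenPartial m (z s) (z t) : ℂ) := by
  -- A nonnegative scalar `c` is `√c * conj √c`, so `conj_mul` also handles the coefficients.
  have h := sum (Finset.range m) (ν := ν) (K := fun n s t =>
    ((√(1 / (2 * (n + 1))) : ℝ) : ℂ) * conj ((√(1 / (2 * (n + 1))) : ℝ) : ℂ) *
      ((szegoSq (z s) (z t) ^ (n + 1) : ℝ) : ℂ))
    (fun n _ => (szegoSq_pow hz hr hzr (n + 1)).conj_mul measurable_const ⟨_, fun _ => le_rfl⟩)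
  convert h using 3 with s t
  rw [ZeroBoundaryGFF.discGreenPartial, Complex.ofReal_sum]
  refine Finset.sum_congr rfl fun n _ => ?_
  rw [Complex.conj_ofReal, ← Complex.ofReal_mul, Real.mul_self_sqrt (by positivity),
    ← Complex.ofReal_mul]
  congr 1
  ring

end IsPosKernel

theorem integral_mul_discGreenPartial_nonneg {T : Type*} [MeasurableSpace T] {ν : Measure T}
    [IsFiniteMeasure ν] {z : T → ℂ} (hz : Measurable z) {r : ℝ} (hr : r < 1)
    (hzr : ∀ t, ‖z t‖ ≤ r) {q : T → ℝ} (hq : Measurable q) (hqb : ∃ C, ∀ t, ‖q t‖ ≤ C) (m : ℕ) :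
    0 ≤ ∫ p : T × T, q p.1 * q p.2 * discGreenPartial m (z p.1) (z p.2) ∂ν.prod ν := by
  have h := (IsPosKernel.discGreenPartial (ν := ν) hz hr hzr m).nonneg (fun t => (q t : ℂ))
    (by fun_prop) (by simpa using hqb)
  simp only [Complex.conj_ofReal, ← Complex.ofReal_mul] at h
  rwa [integral_complex_ofReal, Complex.ofReal_re] at h

/-! ### Onsager's inequality in the disc -/

theorem exists_norm_hypCircle_le {a : ℂ} (ha : ‖a‖ < 1) {ρ : ℝ} (hρ : 0 < ρ) (hρ1 : ρ < 1) :
    ∃ r < 1, ∀ θ, ‖hypCircle a ρ θ‖ ≤ r := by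
  have h1 : 0 < 1 - ‖a‖ ^ 2 := by nlinarith [norm_nonneg a]
  have h2 : 0 < 1 - ρ ^ 2 := by nlinarith
  -- On the circle `1 - |·|²` is a value of `szegoSq`, whose denominator is at most `2² = 4`.
  refine ⟨√(1 - (1 - ‖a‖ ^ 2) * (1 - ρ ^ 2) / 4), ?_, fun θ => ?_⟩
  · rw [Real.sqrt_lt' one_pos]
    have := mul_pos h1 h2
    linarith
  · apply Real.le_sqrt_of_sq_le
    have hc := norm_circleMap_zero_of_nonneg hρ.le θ
    have hc1 : ‖circleMap 0 ρ θ‖ < 1 := by rwa [hc]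
    have ha' : ‖-a‖ < 1 := by simpa using ha
    have h := one_sub_pseudoDist_sq ha' hc1
    rw [← norm_moebius_eq] at h
    have h3 : (1 - ‖a‖ ^ 2) * (1 - ρ ^ 2) / 4 ≤ szegoSq (-a) (circleMap 0 ρ θ) := by
      have h4 : ‖1 - -a * conj (circleMap 0 ρ θ)‖ ≤ 2 := by
        refine (norm_sub_le _ _).trans ?_
        rw [norm_one, norm_mul, RCLike.norm_conj, norm_neg, hc]
        nlinarith [norm_nonneg a]
      have h5 := norm_pos_iff.mpr (one_sub_mul_conj_ne_zero ha' hc1)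
      rw [szegoSq, norm_neg, hc]
      gcongr
      nlinarith
    unfold hypCircle
    linarith

theorem discGreenPartial_le_natCast (m : ℕ) {z w : ℂ} (hz : ‖z‖ < 1) (hw : ‖w‖ < 1) :
    discGreenPartial m z w ≤ m := by
  have h : ∀ n ∈ Finset.range m, szegoSq z w ^ (n + 1) / (2 * (n + 1)) ≤ 1 := fun n _ => by
    have h0 := szegoSq_nonneg hz hw
    have h1 := pow_le_one₀ (n := n + 1) h0 (szegoSq_le_one hz hw)
    rw [div_le_one (by positivity)]
    have : (0 : ℝ) ≤ n := n.cast_nonneg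
    linarith
  simpa [discGreenPartial] using Finset.sum_le_card_nsmul _ _ _ h

theorem integral_count_prod {N : ℕ} {μ : Measure ℝ} [IsFiniteMeasure μ] {H : Fin N × ℝ → ℝ}
    (hH : Integrable H (Measure.count.prod μ)) :
    ∫ t, H t ∂Measure.count.prod μ = ∑ k, ∫ ψ, H (k, ψ) ∂μ := by
  rw [integral_prod H hH, integral_fintype .of_finite]
  simp

theorem integral_count_prod_prod {N : ℕ} {μ : Measure ℝ} [IsFiniteMeasure μ]
    {F : (Fin N × ℝ) × (Fin N × ℝ) → ℝ} (hF : Measurable F) {C : ℝ} (hC : ∀ p, ‖F p‖ ≤ C) :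
    ∫ p, F p ∂(Measure.count.prod μ).prod (Measure.count.prod μ)
      = ∑ j, ∑ k, ∫ θ, ∫ ψ, F ((j, θ), (k, ψ)) ∂μ ∂μ := by
  have hI : Integrable F ((Measure.count.prod μ).prod (Measure.count.prod μ)) :=
    Integrable.of_bound hF.aestronglyMeasurable C (Eventually.of_forall hC)
  rw [integral_prod F hI, integral_count_prod hI.integral_prod_left]
  refine Finset.sum_congr rfl fun j _ => ?_
  have h1 (θ : ℝ) : ∫ t, F ((j, θ), t) ∂Measure.count.prod μ
      = ∑ k, ∫ ψ, F ((j, θ), (k, ψ)) ∂μ :=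
    integral_count_prod (H := fun t => F ((j, θ), t))
      (Integrable.of_bound (hF.comp measurable_prodMk_left).aestronglyMeasurable C
        (Eventually.of_forall fun t => hC _))
  simp_rw [h1]
  refine integral_finsetSum _ fun k _ => ?_
  have h2 : Integrable (fun p : ℝ × ℝ => F ((j, p.1), (k, p.2))) (μ.prod μ) :=
    Integrable.of_bound (hF.comp (by fun_prop :
      Measurable fun p : ℝ × ℝ => ((j, p.1), (k, p.2)))).aestronglyMeasurable C
        (Eventually.of_forall fun t => hC _)
  exact h2.integral_prod_left

/-- Onsager's inequality for the Green's function of the unit disc: point charges with disjoint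
pseudo-hyperbolic discs around them. -/
theorem neg_sum_discGreen_le {N : ℕ} {z : Fin N → ℂ} (hz : ∀ j, ‖z j‖ < 1) {ρ : Fin N → ℝ}
    (hρ : ∀ j, 0 < ρ j) (hρ1 : ∀ j, ρ j < 1)
    (hρz : ∀ j k, j ≠ k → ρ j + ρ k ≤ pseudoDist (z j) (z k)) {q : Fin N → ℝ}
    (hq : ∀ j, q j = 1 ∨ q j = -1) :
    -∑ j, ∑ k ∈ Finset.Ioi j, q j * q k * discGreen (z j) (z k)
      ≤ 1 / 2 * ∑ j, -Real.log (ρ j) := by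
  have hq2 (j : Fin N) : q j * q j = 1 := by rcases hq j with h | h <;> rw [h] <;> norm_num
  have hqn (j : Fin N) : ‖q j‖ = 1 := by rcases hq j with h | h <;> rw [h] <;> norm_num
  -- The energy matrix of the smeared charges, with the self-energies on the diagonal.
  set L : Fin N → Fin N → ℝ := fun j k => if j = k then -Real.log (ρ j) else discGreen (z j) (z k)
    with hL
  have hlim : Tendsto (fun m => ∑ j, ∑ k, q j * q k * ∫ θ, ∫ ψ,
      discGreenPartial m (hypCircle (z j) (ρ j) θ) (hypCircle (z k) (ρ k) ψ)
        ∂angleMeasure ∂angleMeasure) atTop (𝓝 (∑ j, ∑ k, q j * q k * L j k)) := by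
    refine tendsto_finsetSum _ fun j _ => tendsto_finsetSum _ fun k _ => Tendsto.const_mul _ ?_
    have h := tendsto_integral_integral_discGreenPartial (hz k) (hz j) (hρ k) (hρ1 k) (hρ j) (hρ1 j)
    by_cases hjk : j = k
    · subst hjk
      rw [integral_log_max_self (hz j) (hρ j) (hρ1 j)] at h
      simpa [hL] using h
    · rw [integral_log_max_of_add_le (hz k) (hz j) (hρ k) (hρ j) (hρ1 j)
        (hρz k j (Ne.symm hjk)), discGreen_comm] at h
      simpa [hL, hjk] using h
  have hpos : 0 ≤ ∑ j, ∑ k, q j * q k * L j k := by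
    refine ge_of_tendsto hlim (Eventually.of_forall fun m => ?_)
    choose r hr1 hr using fun j => exists_norm_hypCircle_le (hz j) (hρ j) (hρ1 j)
    -- One radius `s < 1` enclosing all the circles; `s < 1` is requested separately so that it also
    -- holds for `N = 0`.
    obtain ⟨s, hs, hs1⟩ := ((eventually_all.2 fun j => Ioo_mem_nhdsLT (hr1 j)).and
      self_mem_nhdsWithin : ∀ᶠ s in 𝓝[<] (1 : ℝ), (∀ j, s ∈ Set.Ioo (r j) 1) ∧ s ∈ Set.Iio 1).exists
    -- All circles are parametrised at once by index and angle, so positivity for a single charge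
    -- density covers the whole configuration.
    have hy : Measurable fun t : Fin N × ℝ => hypCircle (z t.1) (ρ t.1) t.2 :=
      measurable_from_prod_countable_right fun j => measurable_hypCircle (z j) (ρ j)
    have hqm : Measurable fun t : Fin N × ℝ => q t.1 :=
      (measurable_of_finite q).comp measurable_fst
    have h := integral_mul_discGreenPartial_nonneg (ν := Measure.count.prod angleMeasure) hy hs1
      (fun t => (hr t.1 t.2).trans (hs t.1).1.le) hqm ⟨1, fun t => (hqn t.1).le⟩ m
    rw [integral_count_prod_prod (C := m)] at h
    · simpa only [integral_const_mul] using h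
    · exact ((hqm.comp measurable_fst).mul (hqm.comp measurable_snd)).mul
        ((hy.comp measurable_fst).discGreenPartial (hy.comp measurable_snd) m)
    · intro p
      have h1 := norm_hypCircle_lt_one (hz p.1.1) (hρ _) (hρ1 p.1.1) p.1.2
      have h2 := norm_hypCircle_lt_one (hz p.2.1) (hρ _) (hρ1 p.2.1) p.2.2
      rw [norm_mul, norm_mul, hqn, hqn, one_mul, one_mul,
        Real.norm_of_nonneg (discGreenPartial_nonneg m h1 h2)]
      exact discGreenPartial_le_natCast m h1 h2
  have hsplit : ∑ j, ∑ k, q j * q k * L j k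
      = ∑ j, -Real.log (ρ j) + 2 * ∑ j, ∑ k ∈ Finset.Ioi j, q j * q k * discGreen (z j) (z k) := by
    have hsymm (j k : Fin N) : q j * q k * L j k = q k * q j * L k j := by
      simp only [hL, eq_comm (a := j), discGreen_comm (z j)]
      split_ifs with h
      · subst h; rfl
      · ring
    have h1 := Finset.sum_sum_Ioi_add_eq_sum_sum_off_diag fun j k : Fin N => q k * q j * L k j
    have h2 (j : Fin N) : ∑ k, q j * q k * L j k
        = -Real.log (ρ j) + ∑ k ∈ {j}ᶜ, q j * q k * L j k := by
      rw [Fintype.sum_eq_add_sum_compl j]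
      simp [hL, hq2]
    rw [Finset.sum_congr rfl fun j _ => h2 j, Finset.sum_add_distrib, ← h1, Finset.mul_sum]
    congr 1
    refine Finset.sum_congr rfl fun j _ => ?_
    rw [Finset.mul_sum]
    refine Finset.sum_congr rfl fun k hk => ?_
    rw [← hsymm j k]
    simp only [hL, (Finset.mem_Ioi.mp hk).ne, if_false]
    ring
  rw [hsplit] at hpos
  linarith

/-! ### Holomorphy of the inverse map and the Schwarz lemma -/

theorem not_eventually_eq_of_injOn {U : Set ℂ} (hU : IsOpen U) {φ : ℂ → ℂ} (h : Set.InjOn φ U)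
    {x : ℂ} (hx : x ∈ U) : ¬∀ᶠ z in 𝓝 x, φ z = φ x := by
  intro hc
  have h1 : ∀ᶠ z in 𝓝 x, z = x := by
    filter_upwards [hc, hU.mem_nhds hx] with z hz hzU
    exact h hzU hx hz
  obtain ⟨z, hz, hne⟩ := ((h1.filter_mono nhdsWithin_le_nhds).and
    (self_mem_nhdsWithin : {x}ᶜ ∈ 𝓝[≠] x)).exists
  exact hne hz

/-- A left inverse of an injective holomorphic function is holomorphic. -/
theorem differentiableAt_of_leftInvOn {U : Set ℂ} (hU : IsOpen U) {φ f : ℂ → ℂ}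
    (hφ : DifferentiableOn ℂ φ U) (hf : Set.LeftInvOn f φ U) {x : ℂ} (hx : x ∈ U) :
    DifferentiableAt ℂ f (φ x) := by
  have hinj : Set.InjOn φ U := hf.injOn
  -- The open mapping theorem, which makes the inverse continuous.
  have hopen {y : ℂ} (hy : y ∈ U) : 𝓝 (φ y) ≤ map φ (𝓝 y) :=
    ((hφ.analyticAt (hU.mem_nhds hy)).eventually_constant_or_nhds_le_map_nhds).resolve_left
      (not_eventually_eq_of_injOn hU hinj hy)
  have hcont {y : ℂ} (hy : y ∈ U) : ContinuousAt f (φ y) := by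
    have h : Tendsto (f ∘ φ) (𝓝 y) (𝓝 (f (φ y))) := by
      rw [hf hy]
      refine tendsto_id.congr' ?_
      filter_upwards [hU.mem_nhds hy] with z hz
      exact (hf hz).symm
    exact (tendsto_map'_iff.mpr h).mono_left (hopen hy)
  have himage {y : ℂ} (hy : y ∈ U) : φ '' U ∈ 𝓝 (φ y) := hopen hy (image_mem_map (hU.mem_nhds hy))
  have hderiv {y : ℂ} (hy : y ∈ U) (h : deriv φ y ≠ 0) : DifferentiableAt ℂ f (φ y) := by
    have h1 : HasDerivAt φ (deriv φ y) (f (φ y)) := by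
      rw [hf hy]
      exact (hφ.differentiableAt (hU.mem_nhds hy)).hasDerivAt
    refine (HasDerivAt.of_local_left_inverse (hcont hy) h1 h ?_).differentiableAt
    filter_upwards [himage hy] with w hw
    obtain ⟨v, hv, rfl⟩ := hw
    rw [hf hv]
  have hd : AnalyticAt ℂ (deriv φ) x := (hφ.analyticAt (hU.mem_nhds hx)).deriv
  -- Zeros of `φ'` are isolated: otherwise `φ` would be constant near `x`, against injectivity. The
  -- inverse is thus differentiable on a punctured neighbourhood of `φ x`, and the singularity is
  -- removable by continuity.
  have hne : ∀ᶠ z in 𝓝[≠] x, deriv φ z ≠ 0 := by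
    refine hd.eventually_eq_zero_or_eventually_ne_zero.resolve_left fun h0 => ?_
    apply not_eventually_eq_of_injOn hU hinj hx
    obtain ⟨ε, hε, hball⟩ := Metric.eventually_nhds_iff_ball.mp (h0.and (hU.mem_nhds hx))
    filter_upwards [ball_mem_nhds x hε] with z hz
    exact isOpen_ball.is_const_of_deriv_eq_zero (convex_ball x ε).isPreconnected
      (hφ.mono fun y hy => (hball y hy).2) (fun y hy => (hball y hy).1) hz (mem_ball_self hε)
  have hpunct : Tendsto f (𝓝[≠] (φ x)) (𝓝[≠] x) := by
    refine tendsto_nhdsWithin_iff.mpr ⟨?_, ?_⟩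
    · have := (hcont hx).tendsto
      rw [hf hx] at this
      exact this.mono_left nhdsWithin_le_nhds
    · filter_upwards [nhdsWithin_le_nhds (himage hx), self_mem_nhdsWithin] with w hw hwx
      obtain ⟨v, hv, rfl⟩ := hw
      rw [hf hv]
      rintro rfl
      exact hwx rfl
  refine (Complex.analyticAt_of_differentiable_on_punctured_nhds_of_continuousAt ?_
    (hcont hx)).differentiableAt
  filter_upwards [hpunct.eventually hne, nhdsWithin_le_nhds (himage hx)] with w hw hwi
  obtain ⟨v, hv, rfl⟩ := hwi
  rw [hf hv] at hw
  exact hderiv hv hw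

theorem IsConformalToDisc.norm_lt_one {U : Set ℂ} {φ : ℂ → ℂ} (h : IsConformalToDisc U φ) {x : ℂ}
    (hx : x ∈ U) : ‖φ x‖ < 1 := by
  simpa using h.bijOn.mapsTo hx

/-- The Schwarz lemma for the inverse of a conformal bijection onto the disc. -/
theorem IsConformalToDisc.dist_le_mul_pseudoDist {U : Set ℂ} (hU : IsOpen U) {φ : ℂ → ℂ}
    (h : IsConformalToDisc U φ) {R : ℝ} (hR : ∀ x ∈ U, ∀ y ∈ U, dist x y ≤ R) {x y : ℂ}
    (hx : x ∈ U) (hy : y ∈ U) : dist x y ≤ R * pseudoDist (φ x) (φ y) := by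
  set f := Function.invFunOn φ U
  have hf : Set.LeftInvOn f φ U := h.bijOn.injOn.leftInvOn_invFunOn
  have ha := h.norm_lt_one hx
  have ha' : ‖-φ x‖ < 1 := by simpa using ha
  have hmem {u : ℂ} (hu : u ∈ ball (0 : ℂ) 1) : ∃ v ∈ U, φ v = moebius (φ x) u :=
    h.bijOn.surjOn (by simpa using norm_moebius_lt_one ha (by simpa using hu))
  have h0 : moebius (φ x) 0 = φ x := by simp [moebius]
  -- This map sends `0` to `x` and the disc into `U`. The Schwarz lemma is applied at the preimage
  -- of `y`, whose modulus is `pseudoDist (φ x) (φ y)`.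
  have hd : DifferentiableOn ℂ (fun u => f (moebius (φ x) u)) (ball 0 1) := by
    intro u hu
    obtain ⟨v, hv, hvu⟩ := hmem hu
    have h1 : DifferentiableAt ℂ f (moebius (φ x) u) := by
      rw [← hvu]
      exact differentiableAt_of_leftInvOn hU h.differentiableOn hf hv
    have h2 : DifferentiableAt ℂ (moebius (φ x)) u := by
      unfold moebius
      have := one_add_conj_mul_ne_zero ha (by simpa using hu)
      fun_prop (disch := assumption)
    exact (h1.comp u h2).differentiableWithinAt
  have hmaps : Set.MapsTo (fun u => f (moebius (φ x) u)) (ball 0 1)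
      (closedBall (f (moebius (φ x) 0)) R) := by
    intro u hu
    obtain ⟨v, hv, hvu⟩ := hmem hu
    simp only [h0, ← hvu, hf hv, hf hx, mem_closedBall]
    exact hR v hv x hx
  have hw : moebius (-φ x) (φ y) ∈ ball (0 : ℂ) 1 := by
    simpa using norm_moebius_lt_one ha' (h.norm_lt_one hy)
  have := Complex.dist_le_div_mul_dist_of_mapsTo_ball hd hmaps hw
  simp only [h0, moebius_moebius_neg ha (h.norm_lt_one hy), hf hx, hf hy, div_one, dist_zero_right,
    norm_moebius_neg] at this
  rwa [dist_comm]

/-! ### Uniqueness of the pointwise covariance -/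

theorem isOpen_offDiag {U : Set ℂ} (hU : IsOpen U) :
    IsOpen {p : ℂ × ℂ | p.1 ∈ U ∧ p.2 ∈ U ∧ p.1 ≠ p.2} :=
  (hU.preimage continuous_fst).inter ((hU.preimage continuous_snd).inter
    (isOpen_ne_fun continuous_fst continuous_snd))

theorem IsConformalToDisc.continuousOn_greenKernel {U : Set ℂ} {φ : ℂ → ℂ}
    (h : IsConformalToDisc U φ) :
    ContinuousOn (fun p : ℂ × ℂ => greenKernel φ p.1 p.2)
      {p | p.1 ∈ U ∧ p.2 ∈ U ∧ p.1 ≠ p.2} := by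
  have h1 : ContinuousOn (fun p : ℂ × ℂ => φ p.1) {p | p.1 ∈ U ∧ p.2 ∈ U ∧ p.1 ≠ p.2} :=
    h.differentiableOn.continuousOn.comp continuous_fst.continuousOn fun p hp => hp.1
  have h2 : ContinuousOn (fun p : ℂ × ℂ => φ p.2) {p | p.1 ∈ U ∧ p.2 ∈ U ∧ p.1 ≠ p.2} :=
    h.differentiableOn.continuousOn.comp continuous_snd.continuousOn fun p hp => hp.2.1
  have h3 : ∀ p ∈ {p : ℂ × ℂ | p.1 ∈ U ∧ p.2 ∈ U ∧ p.1 ≠ p.2}, φ p.1 - φ p.2 ≠ 0 :=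
    fun p hp h0 => hp.2.2 (h.bijOn.injOn hp.1 hp.2.1 (sub_eq_zero.mp h0))
  unfold greenKernel
  refine ContinuousOn.log (ContinuousOn.norm (ContinuousOn.div ?_ (h1.sub h2) h3)) fun p hp => ?_
  · exact continuousOn_const.sub (h1.mul (Complex.continuous_conj.comp_continuousOn h2))
  · exact norm_ne_zero_iff.mpr (div_ne_zero
      (one_sub_mul_conj_ne_zero (h.norm_lt_one hp.1) (h.norm_lt_one hp.2.1)) (h3 p hp))

/-- The test function given by a smooth bump. -/
noncomputable def bumpTestFunction {c : ℂ} (b : ContDiffBump c) : 𝓓((⊤ : Opens ℂ), ℝ) where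
  toFun := b
  contDiff' := b.contDiff
  hasCompactSupport' := b.hasCompactSupport
  tsupport_subset' := fun _ _ => trivial

/-- If `K > L` at `(x, y)`, this persists on a product of balls inside `U × U`. Bumps supported
there give `K - L` a positive integral, although both kernels represent the same covariance. -/
theorem HasCovarianceKernel.le_of_continuousOn {Ω : Type*} [MeasurableSpace Ω] {P : Measure Ω}
    {X : Ω → 𝓓'((⊤ : Opens ℂ), ℝ)} {U : Set ℂ} (hU : IsOpen U) {K L : ℂ → ℂ → ℝ}
    (hK : HasCovarianceKernel P X U K) (hL : HasCovarianceKernel P X U L)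
    (hKc : ContinuousOn (fun p : ℂ × ℂ => K p.1 p.2) {p | p.1 ∈ U ∧ p.2 ∈ U ∧ p.1 ≠ p.2})
    (hLc : ContinuousOn (fun p : ℂ × ℂ => L p.1 p.2) {p | p.1 ∈ U ∧ p.2 ∈ U ∧ p.1 ≠ p.2})
    {x y : ℂ} (hx : x ∈ U) (hy : y ∈ U) (hxy : x ≠ y) : K x y ≤ L x y := by
  by_contra! hlt
  have hmem := (isOpen_offDiag hU).mem_nhds (show (x, y) ∈ {p : ℂ × ℂ | p.1 ∈ U ∧ p.2 ∈ U ∧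
    p.1 ≠ p.2} from ⟨hx, hy, hxy⟩)
  have hev : ∀ᶠ p in 𝓝 (x, y), p.1 ∈ U ∧ p.2 ∈ U ∧ L p.1 p.2 < K p.1 p.2 := by
    filter_upwards [hmem, (hLc.continuousAt hmem).eventually_lt (hKc.continuousAt hmem) hlt]
      with p hp hp'
    exact ⟨hp.1, hp.2.1, hp'⟩
  obtain ⟨ε, hε, hball⟩ := Metric.eventually_nhds_iff_ball.mp hev
  have hin {p : ℂ × ℂ} (h1 : p.1 ∈ ball x ε) (h2 : p.2 ∈ ball y ε) : p ∈ ball (x, y) ε := by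
    rw [← ball_prod_same]
    exact ⟨h1, h2⟩
  let b : ContDiffBump x := ⟨ε / 2, ε, by linarith, by linarith⟩
  let c : ContDiffBump y := ⟨ε / 2, ε, by linarith, by linarith⟩
  set f := bumpTestFunction b
  set g := bumpTestFunction c
  have hi : IntegrableOn (fun p : ℂ × ℂ => f p.1 * g p.2 * K p.1 p.2 - f p.1 * g p.2 * L p.1 p.2)
      (U ×ˢ U) := (hK.integrableOn f g).sub (hL.integrableOn f g)
  have hzero : ∫ p in U ×ˢ U, (f p.1 * g p.2 * K p.1 p.2 - f p.1 * g p.2 * L p.1 p.2) = 0 := by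
    rw [integral_sub (hK.integrableOn f g) (hL.integrableOn f g), ← hK.integral_mul,
      ← hL.integral_mul, sub_self]
  have hpos : 0 < ∫ p in U ×ˢ U, (f p.1 * g p.2 * K p.1 p.2 - f p.1 * g p.2 * L p.1 p.2) := by
    have hfx (u : ℂ) (hu : u ∉ ball x ε) : f u = 0 := by
      have : u ∉ Function.support b := by rwa [b.support_eq]
      exact Function.notMem_support.mp this
    have hgx (u : ℂ) (hu : u ∉ ball y ε) : g u = 0 := by
      have : u ∉ Function.support c := by rwa [c.support_eq]
      exact Function.notMem_support.mp this
    have hfp (u : ℂ) (hu : u ∈ ball x ε) : 0 < f u := b.pos_of_mem_ball hu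
    have hgp (u : ℂ) (hu : u ∈ ball y ε) : 0 < g u := c.pos_of_mem_ball hu
    have hstrict {p : ℂ × ℂ} (h1 : p.1 ∈ ball x ε) (h2 : p.2 ∈ ball y ε) :
        0 < f p.1 * g p.2 * K p.1 p.2 - f p.1 * g p.2 * L p.1 p.2 := by
      rw [← mul_sub]
      exact mul_pos (mul_pos (hfp _ h1) (hgp _ h2)) (sub_pos.mpr (hball p (hin h1 h2)).2.2)
    rw [setIntegral_pos_iff_support_of_nonneg_ae _ hi]
    · refine lt_of_lt_of_le ?_ (measure_mono (?_ : ball x ε ×ˢ ball y ε ⊆ _))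
      · exact (isOpen_ball.prod isOpen_ball).measure_pos _
          ⟨(x, y), mem_ball_self hε, mem_ball_self hε⟩
      · intro p hp
        have := hball p (hin hp.1 hp.2)
        exact ⟨(hstrict hp.1 hp.2).ne', this.1, this.2.1⟩
    · refine Eventually.of_forall fun p => ?_
      simp only [Pi.zero_apply]
      by_cases h1 : p.1 ∈ ball x ε
      · by_cases h2 : p.2 ∈ ball y ε
        · exact (hstrict h1 h2).le
        · simp [hgx _ h2]
      · simp [hfx _ h1]
  exact hpos.ne' hzero

theorem HasCovarianceKernel.eq_of_continuousOn {Ω : Type*} [MeasurableSpace Ω] {P : Measure Ω}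
    {X : Ω → 𝓓'((⊤ : Opens ℂ), ℝ)} {U : Set ℂ} (hU : IsOpen U) {K L : ℂ → ℂ → ℝ}
    (hK : HasCovarianceKernel P X U K) (hL : HasCovarianceKernel P X U L)
    (hKc : ContinuousOn (fun p : ℂ × ℂ => K p.1 p.2) {p | p.1 ∈ U ∧ p.2 ∈ U ∧ p.1 ≠ p.2})
    (hLc : ContinuousOn (fun p : ℂ × ℂ => L p.1 p.2) {p | p.1 ∈ U ∧ p.2 ∈ U ∧ p.1 ≠ p.2})
    {x y : ℂ} (hx : x ∈ U) (hy : y ∈ U) (hxy : x ≠ y) : K x y = L x y :=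
  le_antisymm (hK.le_of_continuousOn hU hL hKc hLc hx hy hxy)
    (hL.le_of_continuousOn hU hK hLc hKc hx hy hxy)

/-! ### The inequality on the domain -/

theorem minDist_le {N : ℕ} (x : Fin N → ℂ) {j k : Fin N} (h : k ≠ j) :
    minDist x j ≤ ‖x j - x k‖ :=
  ciInf_le (f := fun k : {k : Fin N // k ≠ j} => ‖x j - x k‖) (Set.finite_range _).bddBelow ⟨k, h⟩

theorem minDist_pos {N : ℕ} {x : Fin N → ℂ} (hx : Function.Injective x) {j k : Fin N}
    (h : k ≠ j) : 0 < minDist x j := by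
  have : Nonempty {k : Fin N // k ≠ j} := ⟨⟨k, h⟩⟩
  obtain ⟨i, hi⟩ := exists_eq_ciInf_of_finite (f := fun k : {k : Fin N // k ≠ j} => ‖x j - x k‖)
  rw [minDist, ← hi]
  exact norm_pos_iff.mpr (sub_ne_zero.mpr fun h => i.2 (hx h).symm)

/-- Onsager's inequality for the Green's function of a domain of diameter at most `R`. -/
theorem IsConformalToDisc.neg_sum_greenKernel_le {U : Set ℂ} (hU : IsOpen U) {φ : ℂ → ℂ}
    (h : IsConformalToDisc U φ) {R : ℝ} (hR0 : 0 < R) (hR : ∀ x ∈ U, ∀ y ∈ U, dist x y ≤ R)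
    {N : ℕ} (hN : 2 ≤ N) {q : Fin N → ℝ} (hq : ∀ j, q j = 1 ∨ q j = -1) {x : Fin N → ℂ}
    (hxU : ∀ j, x j ∈ U) (hx : Function.Injective x) :
    -∑ j, ∑ k ∈ Finset.Ioi j, q j * q k * greenKernel φ (x j) (x k) ≤
      1 / 2 * ∑ j, Real.log (1 / (1 / 2 * minDist x j)) + 1 / 2 * Real.log R * N := by
  have : Nontrivial (Fin N) := Fin.nontrivial_iff_two_le.mpr hN
  have hpos (j : Fin N) : 0 < minDist x j := by
    obtain ⟨k, hk⟩ := exists_ne j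
    exact minDist_pos hx hk
  have hle (j : Fin N) : minDist x j ≤ R := by
    obtain ⟨k, hk⟩ := exists_ne j
    exact (minDist_le x hk).trans (by simpa [dist_eq_norm] using hR _ (hxU j) _ (hxU k))
  -- Admissibility of these radii: `d(φ x_j, φ x_k) ≥ |x_j - x_k| / R`, and `|x_j - x_k|` is at
  -- least the mean of the two minimal distances.
  have key := neg_sum_discGreen_le (z := fun j => φ (x j)) (ρ := fun j => minDist x j / (2 * R))
    (fun j => h.norm_lt_one (hxU j)) (fun j => by have := hpos j; positivity)
    (fun j => by
      rw [div_lt_one (by positivity)]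
      linarith [hle j])
    (fun j k hjk => by
      have h1 := h.dist_le_mul_pseudoDist hU hR (hxU j) (hxU k)
      have h2 := minDist_le x hjk.symm
      have h3 := minDist_le x hjk
      rw [norm_sub_rev] at h3
      rw [dist_eq_norm] at h1
      rw [← add_div, div_le_iff₀ (by positivity)]
      linarith) hq
  have hlog (j : Fin N) : -Real.log (minDist x j / (2 * R))
      = Real.log (1 / (1 / 2 * minDist x j)) + Real.log R := by
    have := hpos j
    rw [← Real.log_inv, ← Real.log_mul (by positivity) hR0.ne']
    congr 1
    field_simp
  simp only [hlog, Finset.sum_add_distrib, Finset.sum_const, Finset.card_univ, Fintype.card_fin,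
    nsmul_eq_mul] at key
  simp only [greenKernel_eq_discGreen]
  linarith

end ZeroBoundaryGFF

theorem mainTheorem10 (U : Set ℂ) (hUo : IsOpen U) (hUb : Bornology.IsBounded U)
    (hUs : IsSimplyConnected U) :
    ∃ C : ℝ, 0 < C ∧
      ∀ (Ω : Type*) [MeasurableSpace Ω] (P : Measure Ω) [IsProbabilityMeasure P]
        (X : Ω → 𝓓'((⊤ : Opens ℂ), ℝ)), ZeroBoundaryGFF.IsZeroBoundaryGFF P X U →
      (∃ K : ℂ → ℂ → ℝ, ZeroBoundaryGFF.IsPointwiseCovariance P X U K) ∧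
      ∀ K : ℂ → ℂ → ℝ, ZeroBoundaryGFF.IsPointwiseCovariance P X U K →
        ∀ (N : ℕ), 1 ≤ N → ∀ (q : Fin N → ℝ), (∀ j, q j = 1 ∨ q j = -1) →
        ∀ (x : Fin N → ℂ), (∀ j, x j ∈ U) → Function.Injective x →
          -∑ j : Fin N, ∑ k ∈ Finset.Ioi j, q j * q k * K (x j) (x k) ≤
            1 / 2 * ∑ j : Fin N, Real.log (1 / (1 / 2 * ZeroBoundaryGFF.minDist x j)) + C * N := by
  obtain ⟨D, hD⟩ := Metric.isBounded_iff.mp hUb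
  have hR0 : 0 < max D 1 := lt_max_of_lt_right one_pos
  have hlogR : 0 ≤ Real.log (max D 1) := Real.log_nonneg (le_max_right _ _)
  -- The maximum with `1` makes `log R` nonnegative; the added `1` makes the constant strictly
  -- positive.
  refine ⟨1 / 2 * Real.log (max D 1) + 1, by linarith, fun Ω _ P _ X hX => ?_⟩
  obtain ⟨φ, hφ, hcov⟩ := hX.covariance
  refine ⟨⟨_, hcov, hφ.continuousOn_greenKernel⟩, fun K hK N hN q hq x hxU hx => ?_⟩
  have hKφ : ∑ j : Fin N, ∑ k ∈ Finset.Ioi j, q j * q k * K (x j) (x k)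
      = ∑ j : Fin N, ∑ k ∈ Finset.Ioi j,
        q j * q k * ZeroBoundaryGFF.greenKernel φ (x j) (x k) := by
    refine Finset.sum_congr rfl fun j _ => Finset.sum_congr rfl fun k hk => ?_
    rw [hK.hasCovarianceKernel.eq_of_continuousOn hUo hcov hK.continuousOn
      hφ.continuousOn_greenKernel (hxU j) (hxU k)
      fun h => (Finset.mem_Ioi.mp hk).ne (hx h)]
  rw [hKφ]
  -- For `N = 1` the infimum over the empty type is `0`, and `log (1 / 0) = 0`, so only the constant
  -- remains on the right.
  rcases hN.eq_or_lt with rfl | hN2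
  · have hm (j : Fin 1) : ZeroBoundaryGFF.minDist x j = 0 := by
      have : IsEmpty {k : Fin 1 // k ≠ j} := ⟨fun k => k.2 (Subsingleton.elim _ _)⟩
      exact Real.iInf_of_isEmpty _
    simp [hm]
    linarith
  · have h := hφ.neg_sum_greenKernel_le hUo hR0 (fun a ha b hb => (hD ha hb).trans (le_max_left _ _))
      hN2 hq hxU hx
    have : (0 : ℝ) ≤ N := N.cast_nonneg
    linarith
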